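/- A $C^\infty$-ring is a set $A$ with an operation $\Phi_f:A^n\to A$ for every $n\in\mathbb{N}$ and every $f\in C^\infty(\mathbb{R}^n)$, such that projections act as projections and composites act as composites; through the polynomial operations it is in particular a commutative $\mathbb{R}$-algebra. Let $\mathsf{S}^\infty=(S^\infty,\mu,\eta)$ be the monad on the category $\mathbb{R}\text{-Vec}$ of real vector spaces induced by the functor $C^\infty\text{-Ring}\to\mathbb{R}\text{-Vec}$, which takes underlying vector spaces, and its left adjoint (so $S^\infty(V)$ is the free $C^\infty$-ring on the vector space $V$). Let $\mathsf{m}_V:S^\infty(V)\otimes S^\infty(V)\to S^\infty(V)$ and $\mathsf{u}_V:\mathbb{R}\to S^\infty(V)$ be the multiplication and unit of the $\mathbb{R}$-algebra $S^\infty(V)$. Identify $S^\infty(\mathbb{R}^n)$ with $C^\infty(\mathbb{R}^n)$, with $\eta(e_i)$ the $i$-th coordinate function $x_i$, and identify $\omega=\sum_i f_i\otimes e_i\in C^\infty(\mathbb{R}^n)\otimes\mathbb{R}^n$ with the smooth 1-form $\sum_i f_i\,dx_i$ and with the vector field $F=\langle f_1,\dots,f_n\rangle$. **Theorem.** The free $C^\infty$-ring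 modality $(\mathsf{S}^\infty,\mathsf{m},\mathsf{u})$ carries an integral transformation, that is, a natural transformation $\mathsf{s}_V:S^\infty(V)\otimes V\to S^\infty(V)$ on $\mathbb{R}\text{-Vec}$ such that (composites being written from left to right, and $\sigma$ denoting the symmetry) * $(\mathsf{u}\otimes 1)\mathsf{s}=\eta$; * $(\mathsf{s}\otimes\mathsf{s})\mathsf{m}=(\mathsf{s}\otimes1\otimes1)(\mathsf{m}\otimes1)\mathsf{s}+(1\otimes1\otimes\mathsf{s})(1\otimes\sigma)(\mathsf{m}\otimes1)\mathsf{s}$; * $(\mathsf{s}\otimes1)\mathsf{s}=(1\otimes\sigma)(\mathsf{s}\otimes1)\mathsf{s}$, so that $\mathbb{R}\text{-Vec}$ becomes a co-integral category, with the following properties. 1. For all $n\in\mathbb{N}$, $\omega\in C^\infty(\mathbb{R}^n)\otimes\mathbb{R}^n$ and $\vec v\in\mathbb{R}^n$, the value $\mathsf{s}_{\mathbb{R}^n}(\omega)(\vec v)$ is the integral of $\omega$ along the directed line segment $C_{\vec v}$ from $\vec 0$ to $\vec v$: $$\mathsf{s}_{\mathbb{R}^n}(\omega)(\vec v)=\int_{C_{\vec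 v}}\omega=\int_0^1F(t\vec v)\cdot\vec v\,dt .$$ Moreover, $\mathsf{s}$ is the only integral transformation for $(\mathsf{S}^\infty,\mathsf{m},\mathsf{u})$ with this property. 2. The transformation $\mathsf{s}$ restricts to the polynomial integral transformation. Let $\mathsf{s}^{\mathsf{Sym}}_V:\mathsf{Sym}(V)\otimes V\to\mathsf{Sym}(V)$ be the linear map with $\mathsf{s}^{\mathsf{Sym}}_V((v_1\cdots v_k)\otimes w)=\frac{1}{k+1}v_1\cdots v_kw$, and let $\lambda_V:\mathsf{Sym}(V)\to S^\infty(V)$ be the algebra homomorphism that extends $\eta_V$ (for $V=\mathbb{R}^n$, the inclusion $\mathbb{R}[x_1,\dots,x_n]\subset C^\infty(\mathbb{R}^n)$). Then $(\lambda_V\otimes1)\mathsf{s}_V=\mathsf{s}^{\mathsf{Sym}}_V\lambda_V$ for every real vector space $V$. In particular, on $\mathbb{R}^n$, $$\mathsf{s}_{\mathbb{R}^n}\bigl(x_1^{d_1}\cdots x_n^{d_n}\otimes e_i\bigr)=\frac{1}{1+\sum_jd_j}\,x_1^{d_1}\cdots x_n^{d_n}\,x_i .$$ -/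

import Mathlib

open CategoryTheory MonoidalCategory TensorProduct
open scoped ContDiff

noncomputable section

/-! ### Algebra modalities and co-integral categories -/

universe v u

/-- An algebra modality on a symmetric monoidal category: a monad `(S, μ, η)` together with natural
transformations `m : S C ⊗ S C ⟶ S C` and `u : 𝟙 ⟶ S C` making each `S C` a commutative monoid,
such that each component of `μ` is a morphism of monoids. -/
structure AlgebraModality (C : Type u) [Category.{v} C] [MonoidalCategory C]
    [SymmetricCategory C] where
  /-- the monad `(S, μ, η)` -/
  S : Monad C
  /-- the multiplication -/
  m : ∀ X : C, S.obj X ⊗ S.obj X ⟶ S.obj X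
  /-- the unit of the multiplication -/
  u : ∀ X : C, 𝟙_ C ⟶ S.obj X
  m_natural : ∀ {X Y : C} (f : X ⟶ Y), (S.map f ⊗ₘ S.map f) ≫ m Y = m X ≫ S.map f
  u_natural : ∀ {X Y : C} (f : X ⟶ Y), u X ≫ S.map f = u Y
  unit_mul : ∀ X : C, (u X ▷ S.obj X) ≫ m X = (λ_ (S.obj X)).hom
  mul_unit : ∀ X : C, (S.obj X ◁ u X) ≫ m X = (ρ_ (S.obj X)).hom
  mul_assoc : ∀ X : C, (m X ▷ S.obj X) ≫ m X =
    (α_ (S.obj X) (S.obj X) (S.obj X)).hom ≫ (S.obj X ◁ m X) ≫ m X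
  mul_comm : ∀ X : C, (β_ (S.obj X) (S.obj X)).hom ≫ m X = m X
  m_μ : ∀ X : C, m (S.obj X) ≫ S.μ.app X = (S.μ.app X ⊗ₘ S.μ.app X) ≫ m X
  u_μ : ∀ X : C, u (S.obj X) ≫ S.μ.app X = u X

/-- An integral transformation for an algebra modality on an additive symmetric monoidal category.
A category equipped with such data is a co-integral category. -/
@[ext]
structure IntegralTransformation {C : Type u} [Category.{v} C] [MonoidalCategory C]
    [SymmetricCategory C] [Preadditive C] [MonoidalPreadditive C] (M : AlgebraModality C) where
  /-- the components of the transformation -/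
  app : ∀ X : C, M.S.obj X ⊗ X ⟶ M.S.obj X
  natural : ∀ {X Y : C} (f : X ⟶ Y), (M.S.map f ⊗ₘ f) ≫ app Y = app X ≫ M.S.map f
  /-- integral of a constant: `(u ⊗ 1) s = η` -/
  integral_const : ∀ X : C, (M.u X ▷ X) ≫ app X = (λ_ X).hom ≫ M.S.η.app X
  /-- Rota-Baxter rule: `(s ⊗ s) m = (s ⊗ 1 ⊗ 1)(m ⊗ 1) s + (1 ⊗ 1 ⊗ s)(1 ⊗ σ)(m ⊗ 1) s` -/
  rota_baxter : ∀ X : C, (app X ⊗ₘ app X) ≫ M.m X =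
    (app X ▷ (M.S.obj X ⊗ X)) ≫ (α_ (M.S.obj X) (M.S.obj X) X).inv ≫ (M.m X ▷ X) ≫ app X +
    ((M.S.obj X ⊗ X) ◁ app X) ≫ (α_ (M.S.obj X) X (M.S.obj X)).hom ≫
      (M.S.obj X ◁ (β_ X (M.S.obj X)).hom) ≫ (α_ (M.S.obj X) (M.S.obj X) X).inv ≫
      (M.m X ▷ X) ≫ app X
  /-- interchange: `(s ⊗ 1) s = (1 ⊗ σ)(s ⊗ 1) s` -/
  interchange : ∀ X : C, (app X ▷ X) ≫ app X =
    (α_ (M.S.obj X) X X).hom ≫ (M.S.obj X ◁ (β_ X X).hom) ≫ (α_ (M.S.obj X) X X).inv ≫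
      (app X ▷ X) ≫ app X

/-! ### Smooth functions and `C^∞`-rings -/

/-- The algebra `C^∞(ℝⁿ)` of smooth real-valued functions on `ℝⁿ`. -/
def CInfty (n : ℕ) : Subalgebra ℝ ((Fin n → ℝ) → ℝ) where
  carrier := {f | ContDiff ℝ ∞ f}
  mul_mem' {f g} (hf : ContDiff ℝ ∞ f) (hg : ContDiff ℝ ∞ g) := hf.mul hg
  add_mem' {f g} (hf : ContDiff ℝ ∞ f) (hg : ContDiff ℝ ∞ g) := hf.add hg
  algebraMap_mem' r := (contDiff_const : ContDiff ℝ ∞ fun _ : Fin n → ℝ => r)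

lemma CInfty.contDiff {n : ℕ} (f : CInfty n) : ContDiff ℝ ∞ f.1 := f.2

/-- The `i`-th projection `ℝⁿ → ℝ`. -/
def CInfty.proj {n : ℕ} (i : Fin n) : CInfty n := 
  ⟨fun x => x i, (contDiff_apply ℝ ℝ i : ContDiff ℝ ∞ fun x : Fin n → ℝ => x i)⟩

/-- The composite `g ∘ ⟨f₁, …, fₘ⟩`. -/
def CInfty.comp {m n : ℕ} (g : CInfty m) (f : Fin m → CInfty n) : CInfty n :=
  ⟨fun x => g.1 fun i => (f i).1 x, 
    ContDiff.comp (CInfty.contDiff g) (contDiff_pi.2 fun i => CInfty.contDiff (f i))⟩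

/-- A `C^∞`-ring `(X, Φ)`: a set with an operation `Φ_f : Xⁿ → X` for each `f ∈ C^∞(ℝⁿ)`, where the
projections act as projections and composites as composites (equivalently, a finite power
preserving functor from the category of the spaces `ℝⁿ` and smooth maps to sets). -/
structure CInftyRing where
  /-- the underlying set -/
  carrier : Type
  /-- the operation `Φ_f` -/
  op : ∀ {n : ℕ}, CInfty n → (Fin n → carrier) → carrier
  op_proj : ∀ {n : ℕ} (i : Fin n) (a : Fin n → carrier), op (CInfty.proj i) a = a i
  op_comp : ∀ {m n : ℕ} (g : CInfty m) (f : Fin m → CInfty n) (a : Fin n → carrier),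
    op (CInfty.comp g f) a = op g fun i => op (f i) a

namespace CInftyRing

instance : CoeSort CInftyRing Type := ⟨CInftyRing.carrier⟩

/-- Morphisms of `C^∞`-rings: maps that preserve all the operations. -/
@[ext]
structure Hom (A B : CInftyRing) where
  /-- the underlying map -/
  toFun : A → B
  map_op : ∀ {n : ℕ} (f : CInfty n) (a : Fin n → A),
    toFun (A.op f a) = B.op f fun i => toFun (a i)

instance : Category CInftyRing where
  Hom := Hom
  id A := ⟨id, fun _ _ => rfl⟩
  comp f g := ⟨g.toFun ∘ f.toFun, fun h a => by
    simp only [Function.comp_apply, f.map_op, g.map_op]⟩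

/-! Every `C^∞`-ring is a commutative `ℝ`-algebra, through the polynomial operations. -/

section Algebra

variable (A : CInftyRing)

instance : Zero A := ⟨A.op (0 : CInfty 0) ![]⟩
instance : One A := ⟨A.op (1 : CInfty 0) ![]⟩
instance : Neg A := ⟨fun a => A.op (-CInfty.proj 0 : CInfty 1) ![a]⟩
instance : Add A := ⟨fun a b => A.op (CInfty.proj 0 + CInfty.proj 1 : CInfty 2) ![a, b]⟩
instance : Mul A := ⟨fun a b => A.op (CInfty.proj 0 * CInfty.proj 1 : CInfty 2) ![a, b]⟩
instance : SMul ℝ A := ⟨fun r a => A.op (r • CInfty.proj 0 : CInfty 1) ![a]⟩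

variable {A} {n : ℕ} (x : Fin n → A)

lemma op_op {m : ℕ} (g : CInfty m) (f : Fin m → CInfty n) {h : CInfty n}
    (H : ∀ y, h.1 y = g.1 fun i => (f i).1 y) (b : Fin m → A) (hb : ∀ i, b i = A.op (f i) x) :
    A.op h x = A.op g b := by
  have : h = CInfty.comp g f := Subtype.ext (funext H)
  rw [this, A.op_comp, ← funext hb]

lemma op_zero : A.op (0 : CInfty n) x = 0 :=
  op_op x (0 : CInfty 0) ![] (fun _ => rfl) _ (fun i => i.elim0)

lemma op_one : A.op (1 : CInfty n) x = 1 :=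
  op_op x (1 : CInfty 0) ![] (fun _ => rfl) _ (fun i => i.elim0)

lemma op_neg (f : CInfty n) : A.op (-f) x = -A.op f x :=
  op_op x (-CInfty.proj 0 : CInfty 1) ![f] (fun _ => rfl) _
    (fun i => by fin_cases i; rfl)

lemma op_add (f g : CInfty n) : A.op (f + g) x = A.op f x + A.op g x :=
  op_op x (CInfty.proj 0 + CInfty.proj 1 : CInfty 2) ![f, g] (fun _ => rfl) _
    (fun i => by fin_cases i <;> rfl)

lemma op_mul (f g : CInfty n) : A.op (f * g) x = A.op f x * A.op g x :=
  op_op x (CInfty.proj 0 * CInfty.proj 1 : CInfty 2) ![f, g] (fun _ => rfl) _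
    (fun i => by fin_cases i <;> rfl)

lemma op_smul (r : ℝ) (f : CInfty n) : A.op (r • f) x = r • A.op f x :=
  op_op x (r • CInfty.proj 0 : CInfty 1) ![f] (fun _ => rfl) _
    (fun i => by fin_cases i; rfl)

lemma exists_eq₃ (a b c : A) : ∃ (x : Fin 3 → A) (f g h : CInfty 3),
    a = A.op f x ∧ b = A.op g x ∧ c = A.op h x :=
  ⟨![a, b, c], CInfty.proj 0, CInfty.proj 1, CInfty.proj 2, by simp [A.op_proj]⟩

instance : CommRing A :=
  CommRing.ofMinimalAxioms
    (fun a b c => by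
      obtain ⟨x, f, g, h, rfl, rfl, rfl⟩ := exists_eq₃ a b c
      simp only [← op_add, add_assoc])
    (fun a => by
      obtain ⟨x, f, g, h, rfl, -, -⟩ := exists_eq₃ a a a
      simp only [← op_add, ← op_zero x, zero_add])
    (fun a => by
      obtain ⟨x, f, g, h, rfl, -, -⟩ := exists_eq₃ a a a
      simp only [← op_add, ← op_zero x, ← op_neg, neg_add_cancel])
    (fun a b c => by
      obtain ⟨x, f, g, h, rfl, rfl, rfl⟩ := exists_eq₃ a b c
      simp only [← op_mul, mul_assoc])
    (fun a b => by
      obtain ⟨x, f, g, h, rfl, rfl, -⟩ := exists_eq₃ a b b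
      simp only [← op_mul, mul_comm])
    (fun a => by
      obtain ⟨x, f, g, h, rfl, -, -⟩ := exists_eq₃ a a a
      simp only [← op_mul, ← op_one x, one_mul])
    (fun a b c => by
      obtain ⟨x, f, g, h, rfl, rfl, rfl⟩ := exists_eq₃ a b c
      simp only [← op_mul, ← op_add, mul_add])

instance : Module ℝ A where
  one_smul a := by
    obtain ⟨x, f, g, h, rfl, -, -⟩ := exists_eq₃ a a a
    simp only [← op_smul, one_smul]
  mul_smul r s a := by
    obtain ⟨x, f, g, h, rfl, -, -⟩ := exists_eq₃ a a a
    simp only [← op_smul, mul_smul]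
  smul_zero r := by rw [← op_zero (![] : Fin 0 → A), ← op_smul, smul_zero]
  smul_add r a b := by
    obtain ⟨x, f, g, h, rfl, rfl, -⟩ := exists_eq₃ a b b
    simp only [← op_smul, ← op_add, smul_add]
  add_smul r s a := by
    obtain ⟨x, f, g, h, rfl, -, -⟩ := exists_eq₃ a a a
    simp only [← op_smul, ← op_add, add_smul]
  zero_smul a := by
    obtain ⟨x, f, g, h, rfl, -, -⟩ := exists_eq₃ a a a
    simp only [← op_smul, ← op_zero x, zero_smul]

instance : Algebra ℝ A :=
  Algebra.ofModule
    (fun r a b => by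
      obtain ⟨x, f, g, h, rfl, rfl, -⟩ := exists_eq₃ a b b
      simp only [← op_smul, ← op_mul, smul_mul_assoc])
    (fun r a b => by
      obtain ⟨x, f, g, h, rfl, rfl, -⟩ := exists_eq₃ a b b
      simp only [← op_smul, ← op_mul, mul_smul_comm])

/-- For fixed arguments, `f ↦ Φ_f(x)` is linear. -/
def opHom : CInfty n →ₗ[ℝ] A where
  toFun f := A.op f x
  map_add' := op_add x
  map_smul' := op_smul x

variable {B : CInftyRing} (F : A ⟶ B)

lemma Hom.map_add (a b : A) : F.toFun (a + b) = F.toFun a + F.toFun b := by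
  refine (F.map_op _ _).trans (congrArg (B.op _) (funext fun i => ?_))
  fin_cases i <;> rfl

lemma Hom.map_mul (a b : A) : F.toFun (a * b) = F.toFun a * F.toFun b := by
  refine (F.map_op _ _).trans (congrArg (B.op _) (funext fun i => ?_))
  fin_cases i <;> rfl

lemma Hom.map_smul (r : ℝ) (a : A) : F.toFun (r • a) = r • F.toFun a := by
  refine (F.map_op _ _).trans (congrArg (B.op _) (funext fun i => ?_))
  fin_cases i; rfl

lemma Hom.map_one : F.toFun 1 = 1 := by
  refine (F.map_op _ _).trans (congrArg (B.op _) (funext fun i => i.elim0))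

lemma Hom.map_algebraMap (r : ℝ) :
    F.toFun (algebraMap ℝ A r) = algebraMap ℝ B r := by
  rw [Algebra.algebraMap_eq_smul_one, Algebra.algebraMap_eq_smul_one, Hom.map_smul, Hom.map_one]

/-- The linear map underlying a morphism of `C^∞`-rings. -/
def Hom.toLinearMap : A →ₗ[ℝ] B where
  toFun := F.toFun
  map_add' := Hom.map_add F
  map_smul' := Hom.map_smul F

end Algebra

/-- The functor `U` sending a `C^∞`-ring to its underlying real vector space. -/
def toVect : CInftyRing ⥤ ModuleCat.{0} ℝ where
  obj A := ModuleCat.of ℝ A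
  map F := ModuleCat.ofHom (Hom.toLinearMap F)

end CInftyRing

/-! ### The free `C^∞`-ring on a real vector space -/

section Free

variable (V : Type) [AddCommGroup V] [Module ℝ V]

/-- The free `C^∞`-ring on a real vector space `V`, realized as the set of all functions
`h : V* → ℝ` on the algebraic dual of the form `h(φ) = g(φ(v₁), …, φ(vₙ))` with `g ∈ C^∞(ℝⁿ)` and
`v₁, …, vₙ ∈ V`, with pointwise operations. -/
def FreeCInfty : CInftyRing where
  carrier := {h : Module.Dual ℝ V → ℝ //
    ∃ (n : ℕ) (v : Fin n → V) (g : CInfty n), ∀ φ, h φ = g.1 fun i => φ (v i)}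
  op f h := ⟨fun φ => f.1 fun i => (h i).1 φ, by
    choose n v g hg using fun i => (h i).2
    let e := finSigmaFinEquiv (n := n)
    let w (p : Σ i, Fin (n i)) : V := v p.1 p.2
    refine ⟨_, fun k => w (e.symm k),
      CInfty.comp f fun i => CInfty.comp (g i) fun j => CInfty.proj (e ⟨i, j⟩), fun φ => ?_⟩
    have hw (p) : v p.1 p.2 = w (e.symm (e p)) := by rw [Equiv.symm_apply_apply]
    simp only [CInfty.comp, CInfty.proj, hg, ← hw]⟩
  op_proj _ _ := rfl
  op_comp _ _ _ := rfl

variable {V}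

@[ext]
lemma FreeCInfty.ext {h k : FreeCInfty V} (H : ∀ φ, h.1 φ = k.1 φ) : h = k :=
  Subtype.ext (funext H)

/-- The unit of the free `C^∞`-ring: `v ∈ V` is sent to evaluation at `v`. -/
def FreeCInfty.η : V →ₗ[ℝ] FreeCInfty V where
  toFun v := ⟨fun φ => φ v, 1, ![v], CInfty.proj 0, fun _ => rfl⟩
  map_add' v w := FreeCInfty.ext fun φ => φ.map_add v w
  map_smul' r v := FreeCInfty.ext fun φ => φ.map_smul r v

lemma FreeCInfty.exists_op_η (h : FreeCInfty V) : ∃ (n : ℕ) (v : Fin n → V) (g : CInfty n),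
    h = (FreeCInfty V).op g fun i => FreeCInfty.η (v i) := by
  obtain ⟨n, v, g, hg⟩ := h.2
  exact ⟨n, v, g, FreeCInfty.ext hg⟩

lemma FreeCInfty.op_congr {A : CInftyRing} (F : V →ₗ[ℝ] A) {n m : ℕ} {v : Fin n → V}
    {w : Fin m → V} {g : CInfty n} {k : CInfty m}
    (H : (FreeCInfty V).op g (fun i => FreeCInfty.η (v i)) =
      (FreeCInfty V).op k (fun i => FreeCInfty.η (w i))) :
    A.op g (fun i => F (v i)) = A.op k (fun i => F (w i)) := by
  let W := Submodule.span ℝ (Set.range v ∪ Set.range w)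
  have : FiniteDimensional ℝ W :=
    FiniteDimensional.span_of_finite ℝ ((Set.finite_range v).union (Set.finite_range w))
  let b := Module.finBasis ℝ W
  let lin (y : W) : CInfty _ := ∑ j, b.repr y j • CInfty.proj j
  have key (y : W) : F y = A.op (lin y) fun j => F (b j) := by
    change F y = CInftyRing.opHom _ (lin y)
    conv_lhs => rw [← b.sum_repr y]
    rw [map_sum, Submodule.coe_sum, map_sum]
    refine Finset.sum_congr rfl fun j _ => ?_
    rw [map_smul, Submodule.coe_smul, map_smul]
    exact congrArg _ (A.op_proj j fun j => F (b j)).symm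
  let v' (i : Fin n) : W := ⟨v i, Submodule.subset_span (Or.inl ⟨i, rfl⟩)⟩
  let w' (i : Fin m) : W := ⟨w i, Submodule.subset_span (Or.inr ⟨i, rfl⟩)⟩
  have e : CInfty.comp g (fun i => lin (v' i)) = CInfty.comp k (fun i => lin (w' i)) := by
    refine Subtype.ext (funext fun x => ?_)
    obtain ⟨φ, hφ⟩ := LinearMap.exists_extend (b.constr ℝ x : W →ₗ[ℝ] ℝ)
    have hl (y : W) : (lin y).1 x = φ y := by
      have : φ y = b.constr ℝ x y := by rw [← hφ]; rfl
      rw [this, b.constr_apply_fintype ℝ]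
      simp [lin, CInfty.proj]
    have := congrFun (congrArg Subtype.val H) φ
    simp only [CInfty.comp, hl]
    exact this
  have := congrArg (fun f => A.op f fun j => F (b j)) e
  simpa only [A.op_comp, ← key] using this

/-- The morphism of `C^∞`-rings extending a linear map. -/
def FreeCInfty.lift {A : CInftyRing} (F : V →ₗ[ℝ] A) : FreeCInfty V ⟶ A where
  toFun h := A.op (FreeCInfty.exists_op_η h).choose_spec.choose_spec.choose
    fun i => F ((FreeCInfty.exists_op_η h).choose_spec.choose i)
  map_op {m} f h := by
    choose n v g hg using fun i => FreeCInfty.exists_op_η (h i)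
    let e := finSigmaFinEquiv (n := n)
    let w (p : Σ i, Fin (n i)) : V := v p.1 p.2
    trans A.op (CInfty.comp f fun i => CInfty.comp (g i) fun j => CInfty.proj (e ⟨i, j⟩))
      fun k => F (w (e.symm k))
    · refine FreeCInfty.op_congr F ?_
      refine (FreeCInfty.exists_op_η ((FreeCInfty V).op f h)).choose_spec.choose_spec.choose_spec.symm.trans ?_
      simp only [CInftyRing.op_comp, CInftyRing.op_proj, e, Equiv.symm_apply_apply]
      exact congrArg _ (funext hg)
    · simp only [CInftyRing.op_comp, CInftyRing.op_proj, e, Equiv.symm_apply_apply]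
      congr 1
      funext i
      refine FreeCInfty.op_congr F ?_
      exact (hg i).symm.trans (FreeCInfty.exists_op_η (h i)).choose_spec.choose_spec.choose_spec

lemma FreeCInfty.lift_op_η {A : CInftyRing} (F : V →ₗ[ℝ] A) {n : ℕ} (g : CInfty n)
    (v : Fin n → V) :
    (FreeCInfty.lift F).toFun ((FreeCInfty V).op g fun i => FreeCInfty.η (v i)) =
      A.op g fun i => F (v i) :=
  FreeCInfty.op_congr F (FreeCInfty.exists_op_η
    ((FreeCInfty V).op g fun i => FreeCInfty.η (v i))).choose_spec.choose_spec.choose_spec.symm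

lemma FreeCInfty.lift_η {A : CInftyRing} (F : V →ₗ[ℝ] A) (v : V) :
    (FreeCInfty.lift F).toFun (FreeCInfty.η v) = F v := by
  have := FreeCInfty.lift_op_η F (CInfty.proj 0) ![v]
  rw [CInftyRing.op_proj, CInftyRing.op_proj] at this
  exact this

end Free

/-- The universal property of the free `C^∞`-ring on a vector space. -/
def freeEquiv (V : ModuleCat.{0} ℝ) (A : CInftyRing) :
    (FreeCInfty V ⟶ A) ≃ (V ⟶ CInftyRing.toVect.obj A) where
  toFun F := ModuleCat.ofHom (CInftyRing.Hom.toLinearMap F ∘ₗ FreeCInfty.η)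
  invFun f := FreeCInfty.lift (A := A) f.hom
  left_inv F := by
    refine CInftyRing.Hom.ext (funext fun h => ?_)
    obtain ⟨n, v, g, rfl⟩ := FreeCInfty.exists_op_η h
    rw [F.map_op]
    exact FreeCInfty.lift_op_η _ g v
  right_inv f := by
    ext v
    exact FreeCInfty.lift_η (A := A) f.hom v

/-- The free `C^∞`-ring functor. -/
def freeFunctor : ModuleCat.{0} ℝ ⥤ CInftyRing :=
  Adjunction.leftAdjointOfEquiv (G := CInftyRing.toVect) freeEquiv fun _ _ _ _ _ => rfl

/-- The adjunction between the free `C^∞`-ring functor and the functor `U`. -/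
def freeAdj : freeFunctor ⊣ CInftyRing.toVect :=
  Adjunction.adjunctionOfEquivLeft freeEquiv fun _ _ _ _ _ => rfl

/-- The free `C^∞`-ring modality on real vector spaces: the monad induced by the functor `U` from
`C^∞`-rings to vector spaces, with the algebra structure of the free `C^∞`-rings. -/
def SInfty : AlgebraModality (ModuleCat.{0} ℝ) where
  S := freeAdj.toMonad
  m V := ModuleCat.ofHom (LinearMap.mul' ℝ (FreeCInfty V))
  u V := ModuleCat.ofHom (Algebra.linearMap ℝ (FreeCInfty V))
  m_natural f := ModuleCat.MonoidalCategory.tensor_ext fun a b =>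
    (CInftyRing.Hom.map_mul (freeFunctor.map f) a b).symm
  u_natural f := ModuleCat.hom_ext <| LinearMap.ext fun r =>
    CInftyRing.Hom.map_algebraMap (freeFunctor.map f) r
  unit_mul V := ModuleCat.MonoidalCategory.tensor_ext fun r a =>
    (Algebra.smul_def (R := ℝ) (A := FreeCInfty V) r a).symm
  mul_unit V := ModuleCat.MonoidalCategory.tensor_ext fun a r =>
    ((Algebra.smul_def (R := ℝ) (A := FreeCInfty V) r a).trans (Algebra.commutes (R := ℝ) (A := FreeCInfty V) r a)).symm
  mul_assoc V := ModuleCat.MonoidalCategory.tensor_ext₃' fun a b c =>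
    _root_.mul_assoc (G := FreeCInfty V) a b c
  mul_comm V := ModuleCat.MonoidalCategory.tensor_ext fun a b =>
    _root_.mul_comm (G := FreeCInfty V) b a
  m_μ V := ModuleCat.MonoidalCategory.tensor_ext fun a b =>
    CInftyRing.Hom.map_mul (freeAdj.counit.app (FreeCInfty V)) a b
  u_μ V := ModuleCat.hom_ext <| LinearMap.ext fun r =>
    CInftyRing.Hom.map_algebraMap (freeAdj.counit.app (FreeCInfty V)) r

/-! ### The identification of the free `C^∞`-ring on `ℝⁿ` with `C^∞(ℝⁿ)`, and smooth 1-forms -/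

section Euclidean

variable {n : ℕ}

/-- The linear functional `y ↦ x · y` on `ℝⁿ`. -/
def dotLeft (x : Fin n → ℝ) : Module.Dual ℝ (Fin n → ℝ) := ∑ i, x i • LinearMap.proj i

lemma dotLeft_apply (x y : Fin n → ℝ) : dotLeft x y = x ⬝ᵥ y := by
  simp [dotLeft, dotProduct]

variable (n) in
/-- The canonical isomorphism `C^∞(ℝⁿ) ≅ S^∞(ℝⁿ)`, which sends the `i`-th projection to `η(eᵢ)` and
preserves the operations. -/
def cinftyEquiv : CInfty n ≃ₗ[ℝ] FreeCInfty (Fin n → ℝ) where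
  toFun f := (FreeCInfty (Fin n → ℝ)).op f fun i => FreeCInfty.η (Pi.single i 1)
  map_add' := CInftyRing.op_add _
  map_smul' := CInftyRing.op_smul _
  invFun h := ⟨fun x => h.1 (dotLeft x), by
    obtain ⟨m, v, g, hg⟩ := h.2
    have : ContDiff ℝ ∞ fun x : Fin n → ℝ => g.1 fun i => dotLeft x (v i) := by
      refine (CInfty.contDiff g).comp (contDiff_pi.2 fun i => ?_)
      simp only [dotLeft_apply, dotProduct]
      fun_prop
    simp only [hg]
    exact this⟩
  left_inv f := by
    refine Subtype.ext (funext fun x => congrArg f.1 (funext fun i => ?_))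
    change dotLeft x (Pi.single i 1) = x i
    simp [dotLeft_apply]
  right_inv h := by
    refine FreeCInfty.ext fun φ => congrArg h.1 (LinearMap.ext fun y => ?_)
    change dotLeft (fun i => φ (Pi.single i 1)) y = φ y
    conv_rhs => rw [pi_eq_sum_univ' y]
    simp [dotLeft_apply, dotProduct, mul_comm]

lemma cinftyEquiv_proj (i : Fin n) :
    cinftyEquiv n (CInfty.proj i) = FreeCInfty.η (Pi.single i 1) := rfl

lemma cinftyEquiv_comp {m : ℕ} (g : CInfty m) (f : Fin m → CInfty n) :
    cinftyEquiv n (CInfty.comp g f) = (FreeCInfty _).op g fun i => cinftyEquiv n (f i) := rfl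

variable (n) in
/-- The smooth vector field `F = ⟨f₁, …, fₙ⟩` corresponding to the element `θ = ∑ fᵢ ⊗ eᵢ` of
`C^∞(ℝⁿ) ⊗ ℝⁿ`. -/
def vectorField : CInfty n ⊗[ℝ] (Fin n → ℝ) →ₗ[ℝ] ((Fin n → ℝ) → (Fin n → ℝ)) :=
  TensorProduct.lift <| LinearMap.mk₂ ℝ (fun f w x => f.1 x • w)
    (fun f g w => by ext; simp [add_mul]) (fun r f w => by ext; simp [mul_assoc])
    (fun f w w' => by ext; simp [mul_add]) (fun r f w => by ext; simp [mul_left_comm])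

/-- The smooth 1-form `∑ fᵢ dxᵢ` corresponding to the element `θ = ∑ fᵢ ⊗ eᵢ` of
`C^∞(ℝⁿ) ⊗ ℝⁿ`. -/
def oneForm (θ : CInfty n ⊗[ℝ] (Fin n → ℝ)) (x : Fin n → ℝ) : (Fin n → ℝ) →L[ℝ] ℝ :=
  ∑ i, vectorField n θ x i • ContinuousLinearMap.proj i

/-- The component `C^∞(ℝⁿ) ⊗ ℝⁿ → C^∞(ℝⁿ)` at `ℝⁿ` of a transformation `S^∞(V) ⊗ V → S^∞(V)`. -/
def IntegralTransformation.appRn (s : IntegralTransformation SInfty) (n : ℕ) :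
    CInfty n ⊗[ℝ] (Fin n → ℝ) →ₗ[ℝ] CInfty n :=
  (cinftyEquiv n).symm.toLinearMap ∘ₗ (s.app (ModuleCat.of ℝ (Fin n → ℝ))).hom ∘ₗ
    TensorProduct.map (cinftyEquiv n).toLinearMap LinearMap.id

end Euclidean

/-! ### The polynomial integral transformation -/

section Polynomial

variable (V : Type) [AddCommGroup V] [Module ℝ V]

/-- The algebra homomorphism `Sym(V) → Sym(V)[t]` with `v ↦ v t` for `v ∈ V`. -/
def symScale : SymmetricAlgebra ℝ V →ₐ[ℝ] Polynomial (SymmetricAlgebra ℝ V) :=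
  SymmetricAlgebra.lift
    ((Polynomial.monomial 1).restrictScalars ℝ ∘ₗ SymmetricAlgebra.ι ℝ V)

/-- The linear map `Sym(V)[t] → Sym(V)` given by integration over `0 ≤ t ≤ 1`, that is,
`a tᵏ ↦ a / (k + 1)`. -/
def symInt : Polynomial (SymmetricAlgebra ℝ V) →ₗ[ℝ] SymmetricAlgebra ℝ V :=
  Polynomial.lsum fun k => ((k : ℝ) + 1)⁻¹ • LinearMap.id

/-- The polynomial integral transformation `Sym(V) ⊗ V → Sym(V)`, which sends `(v₁ ⋯ vₖ) ⊗ w` to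
`(v₁ ⋯ vₖ w) / (k + 1)`; see `symIntegral_prod`. -/
def symIntegral : SymmetricAlgebra ℝ V ⊗[ℝ] V →ₗ[ℝ] SymmetricAlgebra ℝ V :=
  LinearMap.mul' ℝ _ ∘ₗ TensorProduct.map (symInt V ∘ₗ (symScale V).toLinearMap)
    (SymmetricAlgebra.ι ℝ V)

lemma symIntegral_prod {k : ℕ} (v : Fin k → V) (w : V) :
    symIntegral V ((∏ i, SymmetricAlgebra.ι ℝ V (v i)) ⊗ₜ w) =
      ((k : ℝ) + 1)⁻¹ • ((∏ i, SymmetricAlgebra.ι ℝ V (v i)) * SymmetricAlgebra.ι ℝ V w) := by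
  have key : symScale V (∏ i, SymmetricAlgebra.ι ℝ V (v i)) =
      Polynomial.monomial k (∏ i, SymmetricAlgebra.ι ℝ V (v i)) := by
    simp only [map_prod, symScale, SymmetricAlgebra.lift_ι_apply, LinearMap.comp_apply,
      LinearMap.restrictScalars_apply, ← Polynomial.C_mul_X_eq_monomial, Finset.prod_mul_distrib]
    simp [Polynomial.C_mul_X_pow_eq_monomial, ← map_prod]
  simp only [symIntegral, LinearMap.comp_apply, TensorProduct.map_tmul, AlgHom.toLinearMap_apply,
    key, LinearMap.mul'_apply]
  simp [symInt, Polynomial.sum_monomial_index]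

/-- The map `λ : Sym(V) → S^∞(V)`, the unique algebra homomorphism that respects the units. For
`V = ℝⁿ` it is the inclusion `ℝ[x₁, …, xₙ] → C^∞(ℝⁿ)`. -/
def symToSInfty : SymmetricAlgebra ℝ V →ₐ[ℝ] FreeCInfty V :=
  SymmetricAlgebra.lift FreeCInfty.η

end Polynomial

end

/-!
The free `C^∞`-ring `S^∞(V)` is realized as an algebra of functions on the dual `V*`, and the
integral transformation sends `h ⊗ w` to the function `φ ↦ (∫₀¹ h(t φ) dt) φ(w)`, the integral of the
1-form `h dw` along the segment from `0` to `φ`. If `h(φ) = g(φ(v₁), …, φ(vₙ))` with `g` smooth, then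
`∫₀¹ h(t φ) dt` is the value at `(φ(v₁), …, φ(vₙ))` of `x ↦ ∫₀¹ g(t x) dt`, which is smooth by
differentiation under the integral sign (`ContDiff.intervalIntegral`).

The axioms are checked at one `φ` at a time. On the ray through `φ` the transformation is the
primitive of a function of one variable (`FreeCInfty.lineIntegral_tmul_smul_apply`), so the
Rota-Baxter rule is integration by parts (`FreeCInfty.lineIntegral_mul`). Interchange holds because
both sides send `h ⊗ v ⊗ w` to `φ(v) φ(w)` times a function of `h` and `φ`, and naturality because `S^∞(f)` is
precomposition with the dual of `f`.

Uniqueness follows from naturality: every pure tensor in `S^∞(V) ⊗ V` comes from some `ℝⁿ`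
(`IntegralTransformation.ext_appRn`). For the restriction to polynomials, evaluation of `λ(a)` at
`t φ` is multiplicative in `a ∈ Sym(V)`, so that `t ↦ λ(a)(t φ)` is a polynomial in `t` which
`symScale` computes; its integral over `[0, 1]` is what `symInt` yields
(`lineIntegral_symToSInfty`, through `radialMean_symToSInfty`).
-/

/-! ### Smooth dependence of integrals on parameters, and integration by parts -/

section ParametricIntegral

variable {E F : Type*} [NormedAddCommGroup E] [NormedSpace ℝ E] [ProperSpace E]
  [NormedAddCommGroup F] [NormedSpace ℝ F]

theorem hasFDerivAt_intervalIntegral_of_contDiff {f : E → ℝ → F}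
    (hf : ContDiff ℝ 1 (Function.uncurry f)) (a b : ℝ) (x₀ : E) :
    HasFDerivAt (fun x => ∫ t in a..b, f x t) (∫ t in a..b, fderiv ℝ (fun x => f x t) x₀) x₀ := by
  have hf' : Continuous (Function.uncurry fun x t => fderiv ℝ (fun x => f x t) x) := by
    have h : ContDiff ℝ 1 (Function.uncurry fun (p : E × ℝ) x => f x p.2) :=
      hf.comp (contDiff_snd.prodMk (contDiff_snd.comp contDiff_fst))
    exact (h.fderiv (m := 1) (n := 0) contDiff_fst (by simp)).continuous
  have hslice (x : E) : Continuous (f x) := hf.continuous.comp (Continuous.prodMk_right x)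
  obtain ⟨C, hC⟩ := ((isCompact_closedBall x₀ 1).prod
    (isCompact_uIcc (a := a) (b := b))).exists_bound_of_continuousOn hf'.continuousOn
  -- The derivative is bounded on the product of a closed ball around `x₀` with the interval.
  refine intervalIntegral.hasFDerivAt_integral_of_dominated_of_fderiv_le
    (F' := fun x t => fderiv ℝ (fun x => f x t) x) (bound := fun _ => C)
    (Metric.closedBall_mem_nhds x₀ one_pos) (.of_forall fun x => (hslice x).aestronglyMeasurable)
    ((hslice x₀).intervalIntegrable a b)
    (Continuous.aestronglyMeasurable (hf'.comp (Continuous.prodMk_right x₀))) ?_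
    intervalIntegrable_const ?_
  · exact .of_forall fun t ht x hx => hC (x, t) ⟨hx, Set.uIoc_subset_uIcc ht⟩
  · refine .of_forall fun t _ x _ => DifferentiableAt.hasFDerivAt ?_
    exact ((hf.comp (contDiff_prodMk_left t)).differentiable one_ne_zero) x

end ParametricIntegral

/-- Induction on the order of differentiability. The target `F` varies in the induction, since the
derivative takes values in `E →L[ℝ] F`; this is why `E` and `F` are in the same universe. -/
theorem contDiff_nat_intervalIntegral.{w} {E F : Type w} [NormedAddCommGroup E] [NormedSpace ℝ E]
    [ProperSpace E] [NormedAddCommGroup F] [NormedSpace ℝ F] {f : E → ℝ → F} (n : ℕ)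
    (hf : ContDiff ℝ n (Function.uncurry f)) (a b : ℝ) :
    ContDiff ℝ n fun x => ∫ t in a..b, f x t := by
  induction n generalizing F with
  | zero =>
    exact contDiff_zero.2 (intervalIntegral.continuous_parametric_intervalIntegral_of_continuous'
      hf.continuous a b)
  | succ n ih =>
    have h1 := hasFDerivAt_intervalIntegral_of_contDiff (hf.of_le (by exact_mod_cast Nat.le_add_left 1 n)) a b
    rw [Nat.cast_succ] at hf ⊢
    refine contDiff_succ_iff_fderiv.2 ⟨fun x => (h1 x).differentiableAt, fun h => by simp at h, ?_⟩
    rw [funext fun x => (h1 x).fderiv]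
    have h : ContDiff ℝ (n + 1) (Function.uncurry fun (p : E × ℝ) x => f x p.2) :=
      hf.comp (contDiff_snd.prodMk (contDiff_snd.comp contDiff_fst))
    exact ih (h.fderiv contDiff_fst le_rfl)

theorem ContDiff.intervalIntegral.{w} {E F : Type w} [NormedAddCommGroup E]
    [NormedSpace ℝ E] [ProperSpace E] [NormedAddCommGroup F] [NormedSpace ℝ F] {f : E → ℝ → F}
    (hf : ContDiff ℝ ∞ (Function.uncurry f)) (a b : ℝ) :
    ContDiff ℝ ∞ fun x => ∫ t in a..b, f x t :=
  contDiff_infty.2 fun n => contDiff_nat_intervalIntegral n (contDiff_infty.1 hf n) a b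

/-- Integration by parts, written as the Rota-Baxter rule for `a ↦ ∫ a` on continuous functions of
one variable. -/
theorem integral_mul_integral_eq_add {a b : ℝ → ℝ} (ha : Continuous a) (hb : Continuous b)
    (T : ℝ) :
    (∫ t in (0 : ℝ)..T, a t) * ∫ t in (0 : ℝ)..T, b t =
      (∫ t in (0 : ℝ)..T, (∫ u in (0 : ℝ)..t, a u) * b t) +
        ∫ t in (0 : ℝ)..T, a t * ∫ u in (0 : ℝ)..t, b u := by
  have hA t : HasDerivAt (fun t => ∫ u in (0 : ℝ)..t, a u) (a t) t :=
    intervalIntegral.integral_hasDerivAt_right (ha.intervalIntegrable _ _)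
      (ha.stronglyMeasurableAtFilter _ _) ha.continuousAt
  have hB t : HasDerivAt (fun t => ∫ u in (0 : ℝ)..t, b u) (b t) t :=
    intervalIntegral.integral_hasDerivAt_right (hb.intervalIntegrable _ _)
      (hb.stronglyMeasurableAtFilter _ _) hb.continuousAt
  have := intervalIntegral.integral_deriv_mul_eq_sub (a := 0) (b := T)
    (fun t _ => hA t) (fun t _ => hB t) (ha.intervalIntegrable _ _) (hb.intervalIntegrable _ _)
  rw [intervalIntegral.integral_same, zero_mul, sub_zero] at this
  rw [← this, add_comm, ← intervalIntegral.integral_add]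
  · exact (ha.mul (continuous_iff_continuousAt.2
      fun t => (hB t).continuousAt)).intervalIntegrable _ _
  · exact (Continuous.mul (continuous_iff_continuousAt.2
      fun t => (hA t).continuousAt) hb).intervalIntegrable _ _

/-! ### Line integrals in the free `C^∞`-ring -/

namespace FreeCInfty

variable {V : Type} [AddCommGroup V] [Module ℝ V]

lemma add_apply (h k : FreeCInfty V) (φ : Module.Dual ℝ V) : (h + k).1 φ = h.1 φ + k.1 φ := rfl

lemma mul_apply (h k : FreeCInfty V) (φ : Module.Dual ℝ V) : (h * k).1 φ = h.1 φ * k.1 φ := rfl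

lemma smul_apply (r : ℝ) (h : FreeCInfty V) (φ : Module.Dual ℝ V) : (r • h).1 φ = r * h.1 φ := rfl

lemma η_apply (v : V) (φ : Module.Dual ℝ V) : (η v).1 φ = φ v := rfl

lemma algebraMap_apply (r : ℝ) (φ : Module.Dual ℝ V) :
    (algebraMap ℝ (FreeCInfty V) r).1 φ = r := by
  rw [Algebra.algebraMap_eq_smul_one]
  exact mul_one r

/-- Evaluation at a functional `φ ∈ V*`, as an algebra homomorphism `S^∞(V) → ℝ`. -/
noncomputable def eval (φ : Module.Dual ℝ V) : FreeCInfty V →ₐ[ℝ] ℝ where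
  toFun h := h.1 φ
  map_one' := rfl
  map_mul' _ _ := rfl
  map_zero' := rfl
  map_add' _ _ := rfl
  commutes' r := algebraMap_apply r φ

lemma eval_apply (φ : Module.Dual ℝ V) (h : FreeCInfty V) : eval φ h = h.1 φ := rfl

lemma continuous_ray (h : FreeCInfty V) (φ : Module.Dual ℝ V) :
    Continuous fun t : ℝ => h.1 (t • φ) := by
  obtain ⟨n, v, g, hg⟩ := h.2
  simp only [hg]
  exact (CInfty.contDiff g).continuous.comp (continuous_pi fun i => by
    simp only [LinearMap.smul_apply]; fun_prop)

variable (V) in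
/-- The mean of a function on `V*` along rays: `h` is sent to `φ ↦ ∫₀¹ h(t φ) dt`. -/
noncomputable def radialMean : FreeCInfty V →ₗ[ℝ] FreeCInfty V where
  toFun h := ⟨fun φ => ∫ t in (0 : ℝ)..1, h.1 (t • φ), by
    obtain ⟨n, v, g, hg⟩ := h.2
    refine ⟨n, v, ⟨fun x => ∫ t in (0 : ℝ)..1, g.1 (t • x), ?_⟩, fun φ => ?_⟩
    · exact ContDiff.intervalIntegral (f := fun x t => g.1 (t • x))
        ((CInfty.contDiff g).comp (contDiff_snd.smul contDiff_fst)) 0 1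
    · simp only [hg]
      rfl⟩
  map_add' h k := FreeCInfty.ext fun φ => intervalIntegral.integral_add
    ((continuous_ray h φ).intervalIntegrable _ _) ((continuous_ray k φ).intervalIntegrable _ _)
  map_smul' r _ := FreeCInfty.ext fun _ => intervalIntegral.integral_const_mul r _

lemma radialMean_apply (h : FreeCInfty V) (φ : Module.Dual ℝ V) :
    (radialMean V h).1 φ = ∫ t in (0 : ℝ)..1, h.1 (t • φ) := rfl

variable (V) in
/-- The linear map `S^∞(V) ⊗ V → S^∞(V)` which sends `h ⊗ w` to `φ ↦ (∫₀¹ h(t φ) dt) φ(w)`, the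
integral of the 1-form `h dw` on `V*` along the segment from `0` to `φ`. -/
noncomputable def lineIntegral : FreeCInfty V ⊗[ℝ] V →ₗ[ℝ] FreeCInfty V :=
  LinearMap.mul' ℝ _ ∘ₗ TensorProduct.map (radialMean V) η

lemma lineIntegral_tmul_apply (h : FreeCInfty V) (w : V) (φ : Module.Dual ℝ V) :
    (lineIntegral V (h ⊗ₜ w)).1 φ = (∫ t in (0 : ℝ)..1, h.1 (t • φ)) * φ w := rfl

/-- On a ray the line integral is the one-variable primitive of `u ↦ h(u φ) φ(w)` that vanishes at
`0`. -/
lemma lineIntegral_tmul_smul_apply (h : FreeCInfty V) (w : V) (φ : Module.Dual ℝ V) (t : ℝ) :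
    (lineIntegral V (h ⊗ₜ w)).1 (t • φ) = ∫ u in (0 : ℝ)..t, h.1 (u • φ) * φ w := by
  rw [lineIntegral_tmul_apply, LinearMap.smul_apply, smul_eq_mul,
    intervalIntegral.integral_mul_const, ← mul_assoc]
  congr 1
  have := intervalIntegral.mul_integral_comp_mul_left (a := 0) (b := 1)
    (f := fun u : ℝ => h.1 (u • φ)) t
  rw [mul_zero, mul_one] at this
  simp only [← this, smul_smul, mul_comm]

lemma lineIntegral_algebraMap (r : ℝ) (w : V) :
    lineIntegral V (algebraMap ℝ (FreeCInfty V) r ⊗ₜ w) = r • η w := by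
  refine FreeCInfty.ext fun φ => ?_
  rw [lineIntegral_tmul_apply, smul_apply, η_apply]
  simp [algebraMap_apply]

/-- The Rota-Baxter rule, which along each ray is integration by parts. -/
lemma lineIntegral_mul (h k : FreeCInfty V) (v w : V) :
    lineIntegral V (h ⊗ₜ v) * lineIntegral V (k ⊗ₜ w) =
      lineIntegral V ((lineIntegral V (h ⊗ₜ v) * k) ⊗ₜ w) +
        lineIntegral V ((h * lineIntegral V (k ⊗ₜ w)) ⊗ₜ v) := by
  refine FreeCInfty.ext fun φ => ?_
  have := integral_mul_integral_eq_add ((continuous_ray h φ).mul_const (φ v))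
    ((continuous_ray k φ).mul_const (φ w)) 1
  simp only [← lineIntegral_tmul_smul_apply, one_smul] at this
  rw [mul_apply, this, add_apply, lineIntegral_tmul_apply, lineIntegral_tmul_apply,
    ← intervalIntegral.integral_mul_const, ← intervalIntegral.integral_mul_const]
  congr 2 <;> funext t <;> simp only [mul_apply] <;> ring

/-- Both sides are `φ ↦ (∫₀¹ t ∫₀¹ h(u t φ) du dt) φ(v) φ(w)`. -/
lemma lineIntegral_interchange (h : FreeCInfty V) (v w : V) :
    lineIntegral V (lineIntegral V (h ⊗ₜ v) ⊗ₜ w) =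
      lineIntegral V (lineIntegral V (h ⊗ₜ w) ⊗ₜ v) := by
  refine FreeCInfty.ext fun φ => ?_
  simp only [lineIntegral_tmul_apply, LinearMap.smul_apply, smul_eq_mul, ← mul_assoc,
    intervalIntegral.integral_mul_const, mul_right_comm]

/-- The free functor acts by precomposition with the dual map. -/
lemma freeFunctor_map_apply {V W : ModuleCat.{0} ℝ} (f : V ⟶ W) (h : FreeCInfty V)
    (φ : Module.Dual ℝ W) : ((freeFunctor.map f).toFun h).1 φ = h.1 (φ ∘ₗ f.hom) := by
  obtain ⟨n, v, g, rfl⟩ := exists_op_η h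
  exact congrFun (congrArg Subtype.val (lift_op_η (A := FreeCInfty W) (η ∘ₗ f.hom) g v)) φ

lemma lineIntegral_natural {V W : ModuleCat.{0} ℝ} (f : V ⟶ W) (h : FreeCInfty V) (w : V) :
    lineIntegral W ((freeFunctor.map f).toFun h ⊗ₜ f.hom w) =
      (freeFunctor.map f).toFun (lineIntegral V (h ⊗ₜ w)) := by
  refine FreeCInfty.ext fun φ => ?_
  rw [freeFunctor_map_apply]
  change (∫ t in (0 : ℝ)..1, ((freeFunctor.map f).toFun h).1 (t • φ)) * φ (f.hom w) =
    (∫ t in (0 : ℝ)..1, h.1 (t • φ ∘ₗ f.hom)) * φ (f.hom w)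
  simp only [freeFunctor_map_apply, LinearMap.smul_comp]

end FreeCInfty

/-- The line integrals `FreeCInfty.lineIntegral`, as an integral transformation. -/
noncomputable def lineIntegralTransformation : IntegralTransformation SInfty where
  app V := ModuleCat.ofHom (FreeCInfty.lineIntegral V)
  natural f := ModuleCat.MonoidalCategory.tensor_ext fun h w =>
    FreeCInfty.lineIntegral_natural f h w
  integral_const V := ModuleCat.MonoidalCategory.tensor_ext fun (r : ℝ) w =>
    (FreeCInfty.lineIntegral_algebraMap r w).trans
      (map_smul (FreeCInfty.η (V := V)) r w).symm
  rota_baxter V := by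
    refine ModuleCat.hom_ext (TensorProduct.ext_fourfold' fun h v k w => ?_)
    exact FreeCInfty.lineIntegral_mul h k v w
  interchange V := ModuleCat.MonoidalCategory.tensor_ext₃' fun h v w =>
    FreeCInfty.lineIntegral_interchange h v w

/-! ### Integrals of smooth 1-forms on `ℝⁿ` along segments -/

lemma lineIntegralTransformation_appRn_tmul {n : ℕ} (f : CInfty n) (w v : Fin n → ℝ) :
    (lineIntegralTransformation.appRn n (f ⊗ₜ w)).1 v =
      (∫ t in (0 : ℝ)..1, f.1 (t • v)) * (v ⬝ᵥ w) := by
  change (∫ t in (0 : ℝ)..1, f.1 fun i => (t • dotLeft v) (Pi.single i 1)) * dotLeft v w = _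
  rw [dotLeft_apply]
  congr 3 with t
  refine congrArg f.1 (funext fun i => ?_)
  simp [dotLeft_apply]

lemma vectorField_tmul {n : ℕ} (f : CInfty n) (w x : Fin n → ℝ) :
    vectorField n (f ⊗ₜ w) x = f.1 x • w := rfl

lemma continuous_vectorField {n : ℕ} (θ : CInfty n ⊗[ℝ] (Fin n → ℝ)) :
    Continuous (vectorField n θ) := by
  induction θ with
  | zero => rw [map_zero]; exact continuous_zero
  | tmul f w => exact (CInfty.contDiff f).continuous.smul continuous_const
  | add θ₁ θ₂ h₁ h₂ => rw [map_add]; exact h₁.add h₂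

lemma curveIntegral_oneForm_segment {n : ℕ} (θ : CInfty n ⊗[ℝ] (Fin n → ℝ)) (v : Fin n → ℝ) :
    curveIntegral (oneForm θ) (Path.segment 0 v) =
      ∫ t in (0 : ℝ)..1, vectorField n θ (t • v) ⬝ᵥ v := by
  rw [curveIntegral_segment]
  simp [oneForm, dotProduct, AffineMap.lineMap_apply]

lemma lineIntegralTransformation_appRn_apply {n : ℕ} (θ : CInfty n ⊗[ℝ] (Fin n → ℝ))
    (v : Fin n → ℝ) : (lineIntegralTransformation.appRn n θ).1 v =
      ∫ t in (0 : ℝ)..1, vectorField n θ (t • v) ⬝ᵥ v := by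
  have hc (θ : CInfty n ⊗[ℝ] (Fin n → ℝ)) :
      Continuous fun t : ℝ => vectorField n θ (t • v) ⬝ᵥ v :=
    ((continuous_vectorField θ).comp (continuous_id.smul continuous_const)).dotProduct
      continuous_const
  induction θ with
  | zero => simp
  | tmul f w =>
    simp only [lineIntegralTransformation_appRn_tmul, vectorField_tmul, smul_dotProduct,
      smul_eq_mul, intervalIntegral.integral_mul_const, dotProduct_comm w]
  | add θ₁ θ₂ h₁ h₂ =>
    simp only [map_add, Pi.add_apply, add_dotProduct]
    rw [intervalIntegral.integral_add ((hc θ₁).intervalIntegrable _ _)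
      ((hc θ₂).intervalIntegrable _ _), ← h₁, ← h₂]
    rfl

/-! ### Uniqueness -/

/-- An integral transformation is determined by its components at the spaces `ℝⁿ`: an element
`g(v₁, …, vₙ) ⊗ w` of `S^∞(V) ⊗ V` is the image of `g(x₁, …, xₙ) ⊗ eₙ₊₁` under the linear map
`ℝⁿ⁺¹ → V` with `eᵢ ↦ vᵢ` for `i ≤ n` and `eₙ₊₁ ↦ w`. -/
lemma IntegralTransformation.ext_appRn {s s' : IntegralTransformation SInfty}
    (H : ∀ n, s.appRn n = s'.appRn n) : s = s' := by
  have app_cinftyEquiv (s : IntegralTransformation SInfty) {n : ℕ} (g : CInfty n)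
      (w : Fin n → ℝ) : (s.app (ModuleCat.of ℝ (Fin n → ℝ))).hom (cinftyEquiv n g ⊗ₜ w) =
        cinftyEquiv n (s.appRn n (g ⊗ₜ w)) :=
    ((cinftyEquiv n).apply_symm_apply _).symm
  ext V : 2
  refine ModuleCat.MonoidalCategory.tensor_ext fun h w => ?_
  obtain ⟨n, v, g, rfl⟩ := FreeCInfty.exists_op_η h
  let f : ModuleCat.of ℝ (Fin (n + 1) → ℝ) ⟶ V :=
    ModuleCat.ofHom (Fintype.linearCombination ℝ (Fin.snoc v w : Fin (n + 1) → V))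
  have hf (i) : f.hom (Pi.single i 1) = (Fin.snoc v w : Fin (n + 1) → V) i := by
    simp [f, Fintype.linearCombination_apply_single]
  let k : CInfty (n + 1) := CInfty.comp g fun i => CInfty.proj i.castSucc
  have hk : (freeFunctor.map f).toFun (cinftyEquiv (n + 1) k) =
      (FreeCInfty V).op g fun i => FreeCInfty.η (v i) := by
    refine (FreeCInfty.lift_op_η (A := FreeCInfty V) (FreeCInfty.η ∘ₗ f.hom) k _).trans ?_
    rw [CInftyRing.op_comp]
    simp only [CInftyRing.op_proj, LinearMap.comp_apply, hf, Fin.snoc_castSucc]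
  have hw : f.hom (Pi.single (Fin.last n) 1) = w := by rw [hf, Fin.snoc_last]
  have key (s : IntegralTransformation SInfty) : (s.app V).hom
      (((FreeCInfty V).op g fun i => FreeCInfty.η (v i)) ⊗ₜ w) = (freeFunctor.map f).toFun
        (cinftyEquiv (n + 1) (s.appRn (n + 1) (k ⊗ₜ Pi.single (Fin.last n) 1))) := by
    rw [← app_cinftyEquiv, ← hk, ← hw]
    exact congrArg (fun F => F.hom (cinftyEquiv (n + 1) k ⊗ₜ Pi.single (Fin.last n) 1))
      (s.natural f)
  exact (key s).trans ((H (n + 1)) ▸ (key s').symm)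

/-! ### Restriction to polynomials -/

section Polynomial

variable {V : Type} [AddCommGroup V] [Module ℝ V]

/-- Under a character `ψ` of `Sym(V)`, the formal integral `symInt` of `q ∈ Sym(V)[t]` becomes the
integral over `[0, 1]` of a real polynomial. -/
lemma map_symInt_eq_integral (ψ : SymmetricAlgebra ℝ V →ₐ[ℝ] ℝ)
    (q : Polynomial (SymmetricAlgebra ℝ V)) :
    ψ (symInt V q) = ∫ t in (0 : ℝ)..1, (q.map (ψ : SymmetricAlgebra ℝ V →+* ℝ)).eval t := by
  induction q using Polynomial.induction_on' with
  | add p q hp hq =>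
    simp only [map_add, hp, hq, Polynomial.map_add, Polynomial.eval_add]
    exact (intervalIntegral.integral_add ((Polynomial.continuous _).intervalIntegrable _ _)
      ((Polynomial.continuous _).intervalIntegrable _ _)).symm
  | monomial k a =>
    simp [symInt, Polynomial.sum_monomial_index, mul_comm, div_eq_mul_inv]

/-- The value at `t φ` of the function given by `a ∈ Sym(V)` is the value at `φ` of the scaling
`symScale`. Both sides are characters of `Sym(V)` in `a`, so they are compared on `V` only. -/
lemma symToSInfty_smul_apply (a : SymmetricAlgebra ℝ V) (φ : Module.Dual ℝ V) (t : ℝ) :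
    (symToSInfty V a).1 (t • φ) = ((symScale V a).map
      ((FreeCInfty.eval φ).comp (symToSInfty V) : SymmetricAlgebra ℝ V →+* ℝ)).eval t := by
  have : (FreeCInfty.eval (t • φ)).comp (symToSInfty V) =
      ((Polynomial.aeval t).comp (Polynomial.mapAlgHom
        ((FreeCInfty.eval φ).comp (symToSInfty V)))).comp (symScale V) := by
    ext v
    simp [symToSInfty, symScale, FreeCInfty.eval_apply, FreeCInfty.η_apply, mul_comm]
  simpa [FreeCInfty.eval_apply] using congrArg (fun F => F a) this

lemma radialMean_symToSInfty (a : SymmetricAlgebra ℝ V) :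
    FreeCInfty.radialMean V (symToSInfty V a) = symToSInfty V (symInt V (symScale V a)) := by
  refine FreeCInfty.ext fun φ => ?_
  rw [FreeCInfty.radialMean_apply]
  simp only [symToSInfty_smul_apply]
  exact (map_symInt_eq_integral ((FreeCInfty.eval φ).comp (symToSInfty V)) (symScale V a)).symm

lemma lineIntegral_symToSInfty (p : SymmetricAlgebra ℝ V ⊗[ℝ] V) :
    FreeCInfty.lineIntegral V
        (TensorProduct.map (symToSInfty V).toLinearMap LinearMap.id p) =
      symToSInfty V (symIntegral V p) := by
  induction p with
  | zero => simp
  | tmul a w =>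
    refine (congrArg (· * FreeCInfty.η w) (radialMean_symToSInfty a)).trans ?_
    simp [symIntegral, symToSInfty]
  | add p q hp hq => simp only [map_add, hp, hq]

end Polynomial

lemma CInfty.coe_prod_proj_pow {n : ℕ} (d : Fin n → ℕ) (x : Fin n → ℝ) :
    (∏ j, CInfty.proj j ^ d j : CInfty n).1 x = ∏ j, x j ^ d j := by
  have : (∏ j, CInfty.proj j ^ d j : CInfty n).1 =
      ∏ j, (CInfty.proj j : CInfty n).1 ^ d j := by
    simp
  rw [this, Finset.prod_apply]
  rfl

lemma lineIntegralTransformation_appRn_monomial {n : ℕ} (d : Fin n → ℕ) (i : Fin n) :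
    lineIntegralTransformation.appRn n ((∏ j, CInfty.proj j ^ d j) ⊗ₜ[ℝ] Pi.single i 1) =
      (1 + ∑ j, (d j : ℝ))⁻¹ • ((∏ j, CInfty.proj j ^ d j) * CInfty.proj i) := by
  refine Subtype.ext (funext fun v => ?_)
  rw [lineIntegralTransformation_appRn_tmul]
  change _ = (1 + ∑ j, (d j : ℝ))⁻¹ * ((∏ j, CInfty.proj j ^ d j : CInfty n).1 v * v i)
  simp only [CInfty.coe_prod_proj_pow, Pi.smul_apply, smul_eq_mul, mul_pow, Finset.prod_mul_distrib,
    Finset.prod_pow_eq_pow_sum, intervalIntegral.integral_mul_const, integral_pow]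
  simp [add_comm, mul_assoc]

theorem mainTheorem1 :
    ∃ s : IntegralTransformation SInfty,
      (∀ (n : ℕ) (θ : CInfty n ⊗[ℝ] (Fin n → ℝ)) (v : Fin n → ℝ),
        (s.appRn n θ).1 v = curveIntegral (oneForm θ) (Path.segment 0 v) ∧
        (s.appRn n θ).1 v = ∫ t in (0 : ℝ)..1, vectorField n θ (t • v) ⬝ᵥ v) ∧
      (∀ s' : IntegralTransformation SInfty,
        (∀ (n : ℕ) (θ : CInfty n ⊗[ℝ] (Fin n → ℝ)) (v : Fin n → ℝ),
          (s'.appRn n θ).1 v = curveIntegral (oneForm θ) (Path.segment 0 v)) → s' = s) ∧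
      (∀ (V : ModuleCat.{0} ℝ) (p : SymmetricAlgebra ℝ V ⊗[ℝ] V),
        (s.app V).hom (TensorProduct.map (symToSInfty V).toLinearMap LinearMap.id p) =
          symToSInfty V (symIntegral V p)) ∧
      (∀ (n : ℕ) (d : Fin n → ℕ) (i : Fin n),
        s.appRn n ((∏ j, CInfty.proj j ^ d j) ⊗ₜ[ℝ] Pi.single i 1) =
          (1 + ∑ j, (d j : ℝ))⁻¹ • ((∏ j, CInfty.proj j ^ d j) * CInfty.proj i)) := by
  refine ⟨lineIntegralTransformation, fun n θ v => ?_, fun s' h => ?_,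
    fun V p => lineIntegral_symToSInfty p, fun n => lineIntegralTransformation_appRn_monomial⟩
  · rw [curveIntegral_oneForm_segment, lineIntegralTransformation_appRn_apply]
    exact ⟨rfl, rfl⟩
  · refine IntegralTransformation.ext_appRn fun n => LinearMap.ext fun θ =>
      Subtype.ext (funext fun v => ?_)
    rw [h, curveIntegral_oneForm_segment, lineIntegralTransformation_appRn_apply]
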